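/- Let $\{T_n:n\ge1\}$ be i.i.d. (almost surely) positive random variables on a probability space $(\Omega,\mathcal F,P)$, not almost surely equal to a constant, and let $\varphi(\alpha)=\log\mathbb E[e^{\alpha T_1}]\in(-\infty,\infty]$ for $\alpha\in\mathbb R$. Assume that $0$ is an interior point of $\{\alpha\in\mathbb R:\varphi(\alpha)<\infty\}$. Let $N(t)=\sum_{n\ge1}1_{\{T_1+\cdots+T_n\le t\}}$ for $t\ge0$ and, for $x>0$, let $$\tau(x)=\inf\{t\ge0:x-N(t)\le0\},\qquad A(x)=\int_0^{\tau(x)}(x-N(t))\,dt .$$ Let $\{a_x:x>0\}$ be any family of positive numbers such that, as $x\to\infty$, $a_x\to0$ and $xa_x\to\infty$, and put $$Z_x=\sqrt{xa_x}\left(\frac{\tau(x)}{x}-\varphi'(0),\ \frac{A(x)}{x^2}-\frac12\varphi'(0)\right),\qquad C=\varphi''(0)\begin{pmatrix}1&1/2\\1/2&1/3\end{pmatrix},\qquad I(z)=\tfrac12\,z^{T}C^{-1}z\quad(z\in\mathbb R^2).$$ Then, as $x\to\infty$, the family $\{Z_x:x>0\}$ satisfies the large deviation principle with speed $1/a_x$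 and good rate function $I$. That is, $1/a_x\to\infty$; the function $I:\mathbb R^2\to[0,\infty]$ is lower semicontinuous with compact level sets $\{z:I(z)\le\eta\}$, $\eta\ge0$; $$\limsup_{x\to\infty}a_x\log P(Z_x\in F)\le-\inf_{z\in F}I(z)\quad\text{for every closed }F\subseteq\mathbb R^2;$$ and $$\liminf_{x\to\infty}a_x\log P(Z_x\in O)\ge-\inf_{z\in O}I(z)\quad\text{for every open }O\subseteq\mathbb R^2$$ (with $\log 0=-\infty$ and $\inf\emptyset=+\infty$). -/

import Mathlib

open MeasureTheory ProbabilityTheory Filter Topology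
open scoped ENNReal Matrix

noncomputable section

namespace RenewalArea

/-- The `n`-th arrival time `T_1 + ⋯ + T_n` of the renewal process with holding times `T_1, T_2, …`.
The sequence is indexed from zero: `T k` is the holding time `T_{k+1}`. -/
def arrivalTime {Ω : Type*} (T : ℕ → Ω → ℝ) (n : ℕ) (ω : Ω) : ℝ :=
  ∑ k ∈ Finset.range n, T k ω

/-- The renewal process `N(t) = ∑_{n ≥ 1} 1_{T_1 + ⋯ + T_n ≤ t}`. -/
def renewalProcess {Ω : Type*} (T : ℕ → Ω → ℝ) (t : ℝ) (ω : Ω) : ℝ≥0∞ :=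
  ∑' n : ℕ, if arrivalTime T (n + 1) ω ≤ t then 1 else 0

/-- The process `X(t) = x - N(t)` started at the level `x`. -/
def levelProcess {Ω : Type*} (T : ℕ → Ω → ℝ) (x t : ℝ) (ω : Ω) : EReal :=
  (x : EReal) - (renewalProcess T t ω : EReal)

/-- The first-passage time `τ(x) = inf {t ≥ 0 : X(t) ≤ 0}`. -/
def passageTime {Ω : Type*} (T : ℕ → Ω → ℝ) (x : ℝ) (ω : Ω) : ℝ :=
  sInf {t : ℝ | 0 ≤ t ∧ levelProcess T x t ω ≤ 0}

/-- The first-passage area `A(x) = ∫_0^{τ(x)} X(t) dt`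
(before `τ(x)` the process `X` takes values in `(0, x]`). -/
def passageArea {Ω : Type*} (T : ℕ → Ω → ℝ) (x : ℝ) (ω : Ω) : ℝ :=
  ∫ t in (0 : ℝ)..passageTime T x ω, (levelProcess T x t ω).toReal

/-- A rate function: lower semicontinuous, with values in `[0, ∞]`. -/
structure IsRateFunction {E : Type*} [TopologicalSpace E] (I : E → EReal) : Prop where
  nonneg : ∀ z, 0 ≤ I z
  lowerSemicontinuous : LowerSemicontinuous I

/-- A good rate function: a rate function all of whose level sets are compact. -/
structure IsGoodRateFunction {E : Type*} [TopologicalSpace E] (I : E → EReal) : Prop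
    extends IsRateFunction I where
  isCompact_level : ∀ η : ℝ, 0 ≤ η → IsCompact {z | I z ≤ (η : EReal)}

/-- The (full) large deviation principle, as `x → ∞`, for the family `Z x` with speed `v x → ∞` and
rate function `I`. Here `ENNReal.log 0 = ⊥` and an infimum over the empty set is `⊤`. -/
structure SatisfiesLDP {Ω E : Type*} [MeasurableSpace Ω] [TopologicalSpace E] (μ : Measure Ω)
    (Z : ℝ → Ω → E) (v : ℝ → ℝ) (I : E → EReal) : Prop where
  speed_tendsto : Tendsto v atTop atTop
  isRateFunction : IsRateFunction I
  upper_bound : ∀ F : Set E, IsClosed F →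
    limsup (fun x : ℝ => ((1 / v x : ℝ) : EReal) * ENNReal.log (μ {ω | Z x ω ∈ F})) atTop
      ≤ -(⨅ z ∈ F, I z)
  lower_bound : ∀ O : Set E, IsOpen O →
    -(⨅ z ∈ O, I z) ≤
      liminf (fun x : ℝ => ((1 / v x : ℝ) : EReal) * ENNReal.log (μ {ω | Z x ω ∈ O})) atTop

/-- The scaled and centered family
`√(x a_x) (τ(x)/x - m, A(x)/x² - m/2)`. -/
def scaledPair {Ω : Type*} (T : ℕ → Ω → ℝ) (a : ℝ → ℝ) (m x : ℝ) (ω : Ω) : Fin 2 → ℝ :=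
  Real.sqrt (x * a x) • ![passageTime T x ω / x - m, passageArea T x ω / x ^ 2 - 1 / 2 * m]

/-- The matrix `s (1, 1/2; 1/2, 1/3)`. -/
def covMatrix (s : ℝ) : Matrix (Fin 2) (Fin 2) ℝ :=
  s • !![1, 1 / 2; 1 / 2, 1 / 3]

/-- The quadratic form `z ↦ ½ zᵀ C⁻¹ z`. -/
def quadraticRate (C : Matrix (Fin 2) (Fin 2) ℝ) (z : Fin 2 → ℝ) : EReal :=
  ((1 / 2 * (z ⬝ᵥ (C⁻¹ *ᵥ z)) : ℝ) : EReal)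

end RenewalArea

end

/-! Almost surely τ(x) and A(x) are linear in the holding times: τ(x) is the sum of `T k` over k <
⌈x⌉ and, since the level is x - k between the k-th and (k+1)-th arrivals, A(x) is the sum of (x - k)
`T k`. Put ε = 1/√(x a_x) and w_k = u₀ + u₁(1 - k/x). Then (u ⬝ᵥ Z_x) / a_x is, up to centering, a
sum of independent terms ε w_k `T k`, with cumulant generating function Σ φ(ε w_k). Since a_x ε² =
1/x, a Taylor expansion at 0 turns a_x times this into φ''(0)/2 times a Riemann sum of ∫₀¹ (u₀ + u₁
s)² ds, while the first-order terms cancel the centering up to O(a_x ε). The limit is ½ uᵀ C u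
(`tendsto_mul_sum_holdingWeight`, `hasQuadraticCumulantLimit_weightedPair`).

A Gärtner–Ellis argument for quadratic limits then yields the principle with the Legendre dual ½ zᵀ
C⁻¹ z. Upper bound: finitely many half-spaces cover the complement of an ellipsoid, and each obeys a
Chernoff bound (`eventually_measureReal_le`). Lower bound: tilting by u = C⁻¹ z concentrates Z_x
near z (`eventually_le_measureReal`). Nondegeneracy gives φ''(0) > 0, so C is positive definite. -/

namespace RenewalArea

/-! ### Positive definite quadratic forms, duality and ellipsoids. -/

section QuadraticForm

variable {ι : Type*} [Fintype ι] {C : Matrix ι ι ℝ}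

lemma dotProduct_mulVec_comm_of_posDef (hC : C.PosDef) (u v : ι → ℝ) :
    u ⬝ᵥ (C *ᵥ v) = v ⬝ᵥ (C *ᵥ u) := by
  have h : Cᵀ = C := by simpa [Matrix.IsHermitian] using hC.1
  rw [Matrix.dotProduct_mulVec, ← Matrix.mulVec_transpose, h, dotProduct_comm]

lemma dotProduct_mulVec_nonneg_of_posDef (hC : C.PosDef) (u : ι → ℝ) :
    0 ≤ u ⬝ᵥ (C *ᵥ u) := by
  simpa using hC.posSemidef.dotProduct_mulVec_nonneg u

lemma dotProduct_mulVec_add_smul (hC : C.PosDef) (u v : ι → ℝ) (t : ℝ) :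
    (u + t • v) ⬝ᵥ (C *ᵥ (u + t • v)) =
      u ⬝ᵥ (C *ᵥ u) + 2 * t * (v ⬝ᵥ (C *ᵥ u)) + t ^ 2 * (v ⬝ᵥ (C *ᵥ v)) := by
  have := dotProduct_mulVec_comm_of_posDef hC u v
  simp only [Matrix.mulVec_add, Matrix.mulVec_smul, add_dotProduct, dotProduct_add,
    smul_dotProduct, dotProduct_smul, smul_eq_mul, this]
  ring

lemma continuous_dotProduct_mulVec (C : Matrix ι ι ℝ) :
    Continuous fun z : ι → ℝ => z ⬝ᵥ (C *ᵥ z) :=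
  continuous_id.dotProduct (continuous_const.matrix_mulVec continuous_id)

variable [DecidableEq ι]

lemma mulVec_inv_mulVec_of_posDef (hC : C.PosDef) (z : ι → ℝ) : C *ᵥ (C⁻¹ *ᵥ z) = z := by
  rw [Matrix.mulVec_mulVec, Matrix.mul_nonsing_inv _ ((Matrix.isUnit_iff_isUnit_det _).1 hC.isUnit),
    Matrix.one_mulVec]

lemma dotProduct_mulVec_inv_mulVec (hC : C.PosDef) (z : ι → ℝ) :
    (C⁻¹ *ᵥ z) ⬝ᵥ (C *ᵥ (C⁻¹ *ᵥ z)) = z ⬝ᵥ (C⁻¹ *ᵥ z) := by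
  rw [mulVec_inv_mulVec_of_posDef hC, dotProduct_comm]

/-- The Fenchel–Young inequality for a positive definite quadratic form. -/
lemma dotProduct_le_half_add_half (hC : C.PosDef) (u z : ι → ℝ) :
    u ⬝ᵥ z ≤ 1 / 2 * (u ⬝ᵥ (C *ᵥ u)) + 1 / 2 * (z ⬝ᵥ (C⁻¹ *ᵥ z)) := by
  have h := dotProduct_mulVec_nonneg_of_posDef hC (u + (-1 : ℝ) • (C⁻¹ *ᵥ z))
  rw [dotProduct_mulVec_add_smul hC, dotProduct_mulVec_inv_mulVec hC,
    dotProduct_mulVec_comm_of_posDef hC (C⁻¹ *ᵥ z), mulVec_inv_mulVec_of_posDef hC] at h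
  linarith

lemma isCompact_setOf_half_le (hC : C.PosDef) (r : ℝ) :
    IsCompact {z : ι → ℝ | 1 / 2 * (z ⬝ᵥ (C⁻¹ *ᵥ z)) ≤ r} := by
  have hcl : IsClosed {z : ι → ℝ | 1 / 2 * (z ⬝ᵥ (C⁻¹ *ᵥ z)) ≤ r} :=
    isClosed_le (continuous_const.mul (continuous_dotProduct_mulVec C⁻¹)) continuous_const
  -- Fenchel–Young with u = ±eᵢ bounds each coordinate: |zᵢ| ≤ ½ Cᵢᵢ + r on the sublevel set.
  refine (isCompact_univ_pi
    (s := fun i => Set.Icc (-(1 / 2 * C i i + r)) (1 / 2 * C i i + r))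
    fun i => isCompact_Icc).of_isClosed_subset hcl ?_
  intro z hz i _
  have h1 := dotProduct_le_half_add_half hC (Pi.single i 1) z
  have h2 := dotProduct_le_half_add_half hC (-Pi.single i 1) z
  simp only [Set.mem_ofPred_eq] at hz
  simp only [neg_dotProduct, Matrix.mulVec_neg, dotProduct_neg, neg_neg, single_one_dotProduct,
    Matrix.mulVec_single_one, Matrix.col_apply] at h1 h2
  exact ⟨by linarith, by linarith⟩

/-- The complement of an ellipsoid is covered by finitely many half-spaces, each of which is bounded
by a hyperplane away from a smaller ellipsoid. -/
lemma exists_finset_halfSpace_cover (hC : C.PosDef) {r r' : ℝ} (hr : 0 ≤ r) (hrr' : r < r') :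
    ∃ t : Finset (ι → ℝ), (∀ u ∈ t, 1 / 2 * (u ⬝ᵥ (C *ᵥ u)) = r') ∧
      ∀ w, r' ≤ 1 / 2 * (w ⬝ᵥ (C⁻¹ *ᵥ w)) → ∃ u ∈ t, r' + r ≤ u ⬝ᵥ w := by
  classical
  set K : Set (ι → ℝ) := {z | 1 / 2 * (z ⬝ᵥ (C⁻¹ *ᵥ z)) = r'}
  have hK : IsCompact K :=
    (isCompact_setOf_half_le hC r').of_isClosed_subset
      (isClosed_eq (continuous_const.mul (continuous_dotProduct_mulVec C⁻¹)) continuous_const)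
      fun z hz => le_of_eq hz
  -- For z in `K`, the vector u = C⁻¹ z satisfies u ⬝ᵥ z = 2r' > r' + r, so the open half-space is a
  -- neighbourhood of z.
  obtain ⟨t, htK, ht⟩ := hK.elim_nhds_subcover (fun z => {w | r' + r < (C⁻¹ *ᵥ z) ⬝ᵥ w}) (by
    intro z hz
    refine (isOpen_lt continuous_const (continuous_const.dotProduct continuous_id)).mem_nhds ?_
    have hz' : 1 / 2 * (z ⬝ᵥ (C⁻¹ *ᵥ z)) = r' := hz
    rw [dotProduct_comm] at hz'
    simp only [Set.mem_ofPred_eq, id]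
    linarith)
  refine ⟨t.image fun z => C⁻¹ *ᵥ z, ?_, ?_⟩
  · intro u hu
    obtain ⟨z, hz, rfl⟩ := Finset.mem_image.1 hu
    rw [dotProduct_mulVec_inv_mulVec hC]
    exact htK z hz
  · intro w hw
    have hr' : 0 < r' := hr.trans_lt hrr'
    set q := 1 / 2 * (w ⬝ᵥ (C⁻¹ *ᵥ w))
    have hq : 0 < q := hr'.trans_le hw
    -- The factor s ≤ 1 pulls w radially back to `K`; a half-space u ⬝ᵥ · > r' + r ≥ 0 containing s
    -- w also contains w.
    set s := Real.sqrt (r' / q)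
    have hs : 0 < s := Real.sqrt_pos.2 (by positivity)
    have hs1 : s ≤ 1 := Real.sqrt_le_one.2 ((div_le_one hq).2 hw)
    have hmem : s • w ∈ K := by
      change 1 / 2 * ((s • w) ⬝ᵥ (C⁻¹ *ᵥ (s • w))) = r'
      have hss : s * s = r' / q := Real.mul_self_sqrt (by positivity)
      calc 1 / 2 * ((s • w) ⬝ᵥ (C⁻¹ *ᵥ (s • w))) = s * s * q := by
            simp only [Matrix.mulVec_smul, smul_dotProduct, dotProduct_smul, smul_eq_mul, q]; ring
        _ = r' := by rw [hss]; field_simp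
    obtain ⟨z, hz, hzw⟩ := Set.mem_iUnion₂.1 (ht hmem)
    refine ⟨_, Finset.mem_image_of_mem _ hz, ?_⟩
    have h : r' + r < s * ((C⁻¹ *ᵥ z) ⬝ᵥ w) := by simpa [dotProduct_smul] using hzw
    have hpos : 0 < (C⁻¹ *ᵥ z) ⬝ᵥ w := by
      by_contra hneg
      have := mul_nonpos_of_nonneg_of_nonpos hs.le (not_lt.1 hneg)
      linarith
    nlinarith

end QuadraticForm

lemma isGoodRateFunction_quadraticRate {C : Matrix (Fin 2) (Fin 2) ℝ} (hC : C.PosDef) :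
    IsGoodRateFunction (quadraticRate C) where
  nonneg z := by
    have := dotProduct_mulVec_nonneg_of_posDef hC.inv z
    exact EReal.coe_nonneg.2 (by positivity)
  lowerSemicontinuous :=
    (continuous_coe_real_ereal.comp
      (continuous_const.mul (continuous_dotProduct_mulVec C⁻¹))).lowerSemicontinuous
  isCompact_level η _ := by
    simpa only [quadraticRate, EReal.coe_le_coe_iff] using isCompact_setOf_half_le hC η

/-- The scaled cumulant generating functions of the family `Z`, at speed `1 / a`, converge to the
quadratic form `u ↦ ½ uᵀ C u`. -/
structure HasQuadraticCumulantLimit {κ Ω ι : Type*} [Fintype ι] [MeasurableSpace Ω] (μ : Measure Ω)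
    (l : Filter κ) (a : κ → ℝ) (Z : κ → Ω → ι → ℝ) (C : Matrix ι ι ℝ) : Prop where
  measurable : ∀ x, Measurable (Z x)
  pos : ∀ᶠ x in l, 0 < a x
  tendsto_zero : Tendsto a l (𝓝 0)
  integrable : ∀ u : ι → ℝ, ∀ᶠ x in l,
    Integrable (fun ω => Real.exp ((a x)⁻¹ * (u ⬝ᵥ Z x ω))) μ
  tendsto_cgf : ∀ u : ι → ℝ,
    Tendsto (fun x => a x * cgf (fun ω => u ⬝ᵥ Z x ω) μ (a x)⁻¹) l (𝓝 (1 / 2 * (u ⬝ᵥ (C *ᵥ u))))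

/-! ### Gärtner–Ellis bounds for a quadratic limit. -/

namespace HasQuadraticCumulantLimit

variable {κ Ω ι : Type*} [Fintype ι] [MeasurableSpace Ω] {μ : Measure Ω} [IsProbabilityMeasure μ]
  {l : Filter κ} {a : κ → ℝ} {Z : κ → Ω → ι → ℝ} {C : Matrix ι ι ℝ}

omit [IsProbabilityMeasure μ] in
-- Constant factors are invisible at speed 1/a: any strict gap between exponents absorbs them.
lemma eventually_mul_exp_le (h : HasQuadraticCumulantLimit μ l a Z C) (K : ℝ) {b c : ℝ}
    (hbc : b < c) : ∀ᶠ x in l, K * Real.exp (b / a x) ≤ Real.exp (c / a x) := by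
  have h1 : Tendsto (fun x => (c - b) * (a x)⁻¹) l atTop :=
    (tendsto_inv_nhdsGT_zero.comp (tendsto_nhdsWithin_iff.2 ⟨h.tendsto_zero, h.pos⟩)).const_mul_atTop
      (sub_pos.2 hbc)
  filter_upwards [(Real.tendsto_exp_atTop.comp h1).eventually_ge_atTop K] with x hx
  calc K * Real.exp (b / a x) ≤ Real.exp ((c - b) * (a x)⁻¹) * Real.exp (b / a x) := by gcongr; exact hx
    _ = Real.exp (c / a x) := by rw [← Real.exp_add]; congr 1; ring

lemma eventually_mgf_le (h : HasQuadraticCumulantLimit μ l a Z C) (u : ι → ℝ) {c : ℝ}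
    (hc : 1 / 2 * (u ⬝ᵥ (C *ᵥ u)) < c) :
    ∀ᶠ x in l, mgf (fun ω => u ⬝ᵥ Z x ω) μ (a x)⁻¹ ≤ Real.exp (c / a x) := by
  filter_upwards [h.pos, h.integrable u, (h.tendsto_cgf u).eventually_lt_const hc] with x hx hi hl
  rw [← exp_cgf hi, Real.exp_le_exp, le_div_iff₀ hx, mul_comm]
  exact hl.le

lemma eventually_exp_le_mgf (h : HasQuadraticCumulantLimit μ l a Z C) (u : ι → ℝ) {c : ℝ}
    (hc : c < 1 / 2 * (u ⬝ᵥ (C *ᵥ u))) :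
    ∀ᶠ x in l, Real.exp (c / a x) ≤ mgf (fun ω => u ⬝ᵥ Z x ω) μ (a x)⁻¹ := by
  filter_upwards [h.pos, h.integrable u, (h.tendsto_cgf u).eventually_const_lt hc] with x hx hi hl
  rw [← exp_cgf hi, Real.exp_le_exp, div_le_iff₀ hx, mul_comm]
  exact hl.le

/-- Chernoff with ½ uᵀ C u = r on each half-space u ⬝ᵥ w ≥ r + r' leaves the exponent -r'; the slack
r' - s absorbs the error in the mgf limit and the number of half-spaces. -/
lemma eventually_measureReal_le [DecidableEq ι] (h : HasQuadraticCumulantLimit μ l a Z C)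
    (hC : C.PosDef) {r r' : ℝ} (hr' : 0 ≤ r') (hrr' : r' < r)
    {F : Set (ι → ℝ)} (hF : ∀ z ∈ F, r ≤ 1 / 2 * (z ⬝ᵥ (C⁻¹ *ᵥ z))) {s : ℝ} (hs : s < r') :
    ∀ᶠ x in l, μ.real {ω | Z x ω ∈ F} ≤ Real.exp (-s / a x) := by
  obtain ⟨t, htr, htF⟩ := exists_finset_halfSpace_cover hC hr' hrr'
  have hmgf : ∀ᶠ x in l, ∀ u ∈ t,
      mgf (fun ω => u ⬝ᵥ Z x ω) μ (a x)⁻¹ ≤ Real.exp ((r + (r' - s) / 2) / a x) :=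
    (Filter.eventually_all_finset t).2 fun u hu => h.eventually_mgf_le u (by rw [htr u hu]; linarith)
  have hint : ∀ᶠ x in l, ∀ u ∈ t, Integrable (fun ω => Real.exp ((a x)⁻¹ * (u ⬝ᵥ Z x ω))) μ :=
    (Filter.eventually_all_finset t).2 fun u _ => h.integrable u
  filter_upwards [h.pos, hmgf, hint,
    h.eventually_mul_exp_le t.card (b := -r' + (r' - s) / 2) (c := -s) (by linarith)] with x hx hm hi hK
  calc μ.real {ω | Z x ω ∈ F}
      ≤ μ.real (⋃ u ∈ t, {ω | r + r' ≤ u ⬝ᵥ Z x ω}) := by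
        refine measureReal_mono (fun ω hω => ?_) (measure_ne_top _ _)
        obtain ⟨u, hu, hle⟩ := htF _ (hF _ hω)
        exact Set.mem_iUnion₂.2 ⟨u, hu, hle⟩
    _ ≤ ∑ u ∈ t, μ.real {ω | r + r' ≤ u ⬝ᵥ Z x ω} := measureReal_biUnion_finset_le _ _
    _ ≤ ∑ u ∈ t, Real.exp ((-r' + (r' - s) / 2) / a x) := by
        refine Finset.sum_le_sum fun u hu => ?_
        calc μ.real {ω | r + r' ≤ u ⬝ᵥ Z x ω}
            ≤ Real.exp (-(a x)⁻¹ * (r + r')) * mgf (fun ω => u ⬝ᵥ Z x ω) μ (a x)⁻¹ :=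
              measure_ge_le_exp_mul_mgf _ (inv_nonneg.2 hx.le) (hi u hu)
          _ ≤ Real.exp (-(a x)⁻¹ * (r + r')) * Real.exp ((r + (r' - s) / 2) / a x) := by
              gcongr; exact hm u hu
          _ = Real.exp ((-r' + (r' - s) / 2) / a x) := by
              rw [← Real.exp_add]; congr 1; ring
    _ ≤ Real.exp (-s / a x) := by simpa using hK

/-- Under the measure tilted by `u`, the half-spaces not containing `C u` are negligible. -/
lemma eventually_mul_setIntegral_le (h : HasQuadraticCumulantLimit μ l a Z C) (hC : C.PosDef)
    (u v : ι → ℝ) {δ : ℝ} (hδ : 0 < δ) (K : ℝ) :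
    ∀ᶠ x in l, K * ∫ ω in {ω | v ⬝ᵥ (C *ᵥ u) + δ ≤ v ⬝ᵥ Z x ω}, Real.exp ((a x)⁻¹ * (u ⬝ᵥ Z x ω)) ∂μ
      ≤ mgf (fun ω => u ⬝ᵥ Z x ω) μ (a x)⁻¹ := by
  set Q := v ⬝ᵥ (C *ᵥ v)
  have hQ : 0 ≤ Q := dotProduct_mulVec_nonneg_of_posDef hC v
  -- Tilting further by θ v gains θ δ and costs ½ θ² Q; the choice δ / (1 + Q) keeps the cost at
  -- most half the gain.
  obtain ⟨θ, hθ, hθδ⟩ : ∃ θ > 0, 1 / 2 * θ ^ 2 * Q < θ * δ := by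
    refine ⟨δ / (1 + Q), by positivity, ?_⟩
    have : 1 / 2 * (δ / (1 + Q)) ^ 2 * Q = (δ / (1 + Q) * δ) * (1 / 2 * (Q / (1 + Q))) := by
      field_simp
    rw [this]
    have h1 : Q / (1 + Q) ≤ 1 := (div_le_one (by positivity)).2 (by linarith)
    have h2 : 0 < δ / (1 + Q) * δ := by positivity
    nlinarith
  set ε := θ * δ - 1 / 2 * θ ^ 2 * Q
  have hε : 0 < ε := sub_pos.2 hθδ
  set L := 1 / 2 * (u ⬝ᵥ (C *ᵥ u))
  have hL : 1 / 2 * ((u + θ • v) ⬝ᵥ (C *ᵥ (u + θ • v)))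
      < L + θ * (v ⬝ᵥ (C *ᵥ u)) + 1 / 2 * θ ^ 2 * Q + ε / 3 := by
    rw [dotProduct_mulVec_add_smul hC]
    simp only [L, Q]
    linarith
  filter_upwards [h.pos, h.integrable u, h.integrable (u + θ • v), h.eventually_mgf_le _ hL,
    h.eventually_exp_le_mgf u (sub_lt_self L (by positivity : 0 < ε / 3)),
    h.eventually_mul_exp_le |K| (b := L - ε + ε / 3) (c := L - ε / 3) (by linarith)]
    with x hx hi hi' hle hge hK
  have hmeas : MeasurableSet {ω | v ⬝ᵥ (C *ᵥ u) + δ ≤ v ⬝ᵥ Z x ω} :=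
    measurableSet_le measurable_const
      ((Continuous.dotProduct continuous_const continuous_id).measurable.comp (h.measurable x))
  have hset : ∫ ω in {ω | v ⬝ᵥ (C *ᵥ u) + δ ≤ v ⬝ᵥ Z x ω}, Real.exp ((a x)⁻¹ * (u ⬝ᵥ Z x ω)) ∂μ
      ≤ Real.exp ((L - ε + ε / 3) / a x) := by
    -- On the half-space the extra factor exp(θ (v ⬝ᵥ Z - v ⬝ᵥ C u - δ) / a) is at least 1.
    set c := Real.exp (-(θ * (v ⬝ᵥ (C *ᵥ u) + δ)) / a x)
    calc ∫ ω in {ω | v ⬝ᵥ (C *ᵥ u) + δ ≤ v ⬝ᵥ Z x ω}, Real.exp ((a x)⁻¹ * (u ⬝ᵥ Z x ω)) ∂μ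
        ≤ ∫ ω in {ω | v ⬝ᵥ (C *ᵥ u) + δ ≤ v ⬝ᵥ Z x ω},
            c * Real.exp ((a x)⁻¹ * ((u + θ • v) ⬝ᵥ Z x ω)) ∂μ := by
          refine setIntegral_mono_on hi.integrableOn (hi'.const_mul c).integrableOn hmeas
            fun ω hω => ?_
          rw [← Real.exp_add, Real.exp_le_exp, add_dotProduct, smul_dotProduct, smul_eq_mul,
            div_eq_mul_inv]
          have h3 : 0 ≤ (a x)⁻¹ * (θ * (v ⬝ᵥ Z x ω - (v ⬝ᵥ (C *ᵥ u) + δ))) :=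
            mul_nonneg (inv_nonneg.2 hx.le) (mul_nonneg hθ.le (sub_nonneg.2 hω))
          linarith
      _ ≤ ∫ ω, c * Real.exp ((a x)⁻¹ * ((u + θ • v) ⬝ᵥ Z x ω)) ∂μ :=
          setIntegral_le_integral (hi'.const_mul c) (ae_of_all _ fun ω => by positivity)
      _ = c * mgf (fun ω => (u + θ • v) ⬝ᵥ Z x ω) μ (a x)⁻¹ := integral_const_mul _ _
      _ ≤ c * Real.exp ((L + θ * (v ⬝ᵥ (C *ᵥ u)) + 1 / 2 * θ ^ 2 * Q + ε / 3) / a x) := by gcongr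
      _ = Real.exp ((L - ε + ε / 3) / a x) := by
          rw [← Real.exp_add]; congr 1; simp only [ε]; ring
  calc _ ≤ |K| * _ := mul_le_mul_of_nonneg_right (le_abs_self K)
        (integral_nonneg fun ω => (Real.exp_pos _).le)
    _ ≤ |K| * Real.exp ((L - ε + ε / 3) / a x) := by gcongr
    _ ≤ _ := hK.trans hge

/-- Change of measure: the weight exp(u ⬝ᵥ Z / a), u = C⁻¹ z, has at least half its mass on a small
ball about z, where it is at most exp((u ⬝ᵥ z + η/3) / a). Dividing leaves the cost u ⬝ᵥ z - ½ uᵀ C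
u = ½ zᵀ C⁻¹ z. -/
lemma eventually_le_measureReal [DecidableEq ι] (h : HasQuadraticCumulantLimit μ l a Z C)
    (hC : C.PosDef) {z : ι → ℝ} {U : Set (ι → ℝ)} (hU : U ∈ 𝓝 z) {η : ℝ} (hη : 0 < η) :
    ∀ᶠ x in l, Real.exp (-(1 / 2 * (z ⬝ᵥ (C⁻¹ *ᵥ z)) + η) / a x) ≤ μ.real {ω | Z x ω ∈ U} := by
  set u := C⁻¹ *ᵥ z
  have hCu : C *ᵥ u = z := mulVec_inv_mulVec_of_posDef hC z
  set L := 1 / 2 * (u ⬝ᵥ (C *ᵥ u))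
  have hL : 1 / 2 * (z ⬝ᵥ u) = u ⬝ᵥ z - L := by
    simp only [L, hCu, dotProduct_comm z u]; ring
  have hV : U ∩ {w | u ⬝ᵥ w < u ⬝ᵥ z + η / 3} ∈ 𝓝 z :=
    inter_mem hU ((isOpen_lt (continuous_const.dotProduct continuous_id)
      continuous_const).mem_nhds (by simp only [Set.mem_ofPred_eq, id]; linarith))
  obtain ⟨δ, hδ, hball⟩ := Metric.mem_nhds_iff.1 hV
  -- The directions ±eᵢ cut out the sup-norm ball, so a point outside it lies in some `H j x`.
  set v : ι × Bool → ι → ℝ := fun j => bif j.2 then Pi.single j.1 1 else -Pi.single j.1 1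
  set H : ι × Bool → κ → Set Ω := fun j x => {ω | v j ⬝ᵥ (C *ᵥ u) + δ ≤ v j ⬝ᵥ Z x ω}
  set n : ℝ := ((Fintype.card (ι × Bool) : ℕ) : ℝ)
  -- Each of the n half-spaces gets at most 1 / (2n + 1) of the tilted mass, hence together at most
  -- half, n = 0 included.
  have hbad : ∀ᶠ x in l, ∀ j, (2 * n + 1) * ∫ ω in H j x, Real.exp ((a x)⁻¹ * (u ⬝ᵥ Z x ω)) ∂μ
      ≤ mgf (fun ω => u ⬝ᵥ Z x ω) μ (a x)⁻¹ :=
    Filter.eventually_all.2 fun j => h.eventually_mul_setIntegral_le hC u (v j) hδ _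
  filter_upwards [h.pos, h.integrable u, hbad,
    h.eventually_exp_le_mgf u (sub_lt_self L (by positivity : 0 < η / 3)),
    h.eventually_mul_exp_le 2 (b := L - η + η / 3) (c := L - η / 3) (by linarith)]
    with x hx hi hbad hge h2
  set f : Ω → ℝ := fun ω => Real.exp ((a x)⁻¹ * (u ⬝ᵥ Z x ω))
  set B : Set Ω := {ω | Z x ω ∈ Metric.ball z δ}
  have hBmeas : MeasurableSet B := h.measurable x Metric.isOpen_ball.measurableSet
  have hHmeas : ∀ j, MeasurableSet (H j x) := fun j =>
    measurableSet_le measurable_const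
      ((Continuous.dotProduct continuous_const continuous_id).measurable.comp (h.measurable x))
  have hcover : ∀ ω, f ω ≤ B.indicator f ω + ∑ j, (H j x).indicator f ω := by
    intro ω
    have hnn : ∀ j, 0 ≤ (H j x).indicator f ω := fun j =>
      Set.indicator_nonneg (fun _ _ => (Real.exp_pos _).le) _
    by_cases hB : ω ∈ B
    · rw [Set.indicator_of_mem hB]
      linarith [Finset.sum_nonneg fun j (_ : j ∈ Finset.univ) => hnn j]
    · rw [Set.indicator_of_notMem hB, zero_add]
      have hex : ∃ j, ω ∈ H j x := by
        by_contra hno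
        refine hB ((dist_pi_lt_iff hδ).2 fun i => ?_)
        rw [not_exists] at hno
        have ht := hno (i, true)
        have hf := hno (i, false)
        simp only [H, v, hCu, Set.mem_ofPred_eq, not_le, cond_true, cond_false, neg_dotProduct,
          single_one_dotProduct] at ht hf
        rw [Real.dist_eq, abs_lt]
        constructor <;> linarith
      obtain ⟨j, hj⟩ := hex
      calc f ω = (H j x).indicator f ω := (Set.indicator_of_mem hj f).symm
        _ ≤ _ := Finset.single_le_sum (f := fun j => (H j x).indicator f ω) (fun j _ => hnn j)
            (Finset.mem_univ j)
  have hsplit : mgf (fun ω => u ⬝ᵥ Z x ω) μ (a x)⁻¹ ≤ (∫ ω in B, f ω ∂μ) + ∑ j, ∫ ω in H j x, f ω ∂μ := by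
    calc ∫ ω, f ω ∂μ ≤ ∫ ω, (B.indicator f ω + ∑ j, (H j x).indicator f ω) ∂μ :=
          integral_mono hi ((hi.indicator hBmeas).add
            (integrable_finsetSum _ fun j _ => hi.indicator (hHmeas j))) hcover
      _ = _ := by
          rw [integral_add (hi.indicator hBmeas)
            (integrable_finsetSum _ fun j _ => hi.indicator (hHmeas j)),
            integral_finsetSum _ fun j _ => hi.indicator (hHmeas j), integral_indicator hBmeas]
          simp only [integral_indicator (hHmeas _)]
  set M := mgf (fun ω => u ⬝ᵥ Z x ω) μ (a x)⁻¹
  have hsum : (2 * n + 1) * ∑ j, ∫ ω in H j x, f ω ∂μ ≤ n * M := by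
    rw [Finset.mul_sum]
    calc _ ≤ ∑ _j : ι × Bool, M := Finset.sum_le_sum fun j _ => hbad j
      _ = n * M := by simp [n]
  have hn : 0 ≤ n := Nat.cast_nonneg _
  have hM : 0 ≤ M := mgf_nonneg
  have hhalf : M ≤ 2 * ∫ ω in B, f ω ∂μ := by
    have hS : 0 ≤ ∑ j, ∫ ω in H j x, f ω ∂μ :=
      Finset.sum_nonneg fun j _ => integral_nonneg fun ω => (Real.exp_pos _).le
    have : ∑ j, ∫ ω in H j x, f ω ∂μ ≤ M / 2 := by
      have h5 : (2 * n + 1) * ∑ j, ∫ ω in H j x, f ω ∂μ ≤ (2 * n + 1) * (M / 2) := by linarith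
      exact le_of_mul_le_mul_left h5 (by positivity)
    linarith
  have hBle : ∫ ω in B, f ω ∂μ ≤ Real.exp ((u ⬝ᵥ z + η / 3) / a x) * μ.real {ω | Z x ω ∈ U} := by
    calc ∫ ω in B, f ω ∂μ ≤ ∫ ω in B, Real.exp ((u ⬝ᵥ z + η / 3) / a x) ∂μ := by
          refine setIntegral_mono_on hi.integrableOn (integrable_const _).integrableOn hBmeas
            fun ω hω => ?_
          have h6 : u ⬝ᵥ Z x ω < u ⬝ᵥ z + η / 3 := (hball hω).2
          rw [Real.exp_le_exp, div_eq_inv_mul]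
          exact mul_le_mul_of_nonneg_left h6.le (inv_nonneg.2 hx.le)
      _ = Real.exp ((u ⬝ᵥ z + η / 3) / a x) * μ.real B := by
          rw [setIntegral_const, smul_eq_mul, mul_comm]
      _ ≤ _ := mul_le_mul_of_nonneg_left
          (measureReal_mono (fun ω hω => (hball hω).1) (measure_ne_top _ _)) (Real.exp_pos _).le
  have hkey : Real.exp ((L - η + η / 3) / a x)
      ≤ Real.exp ((u ⬝ᵥ z + η / 3) / a x) * μ.real {ω | Z x ω ∈ U} := by linarith
  have hexp : Real.exp ((L - η + η / 3) / a x) =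
      Real.exp ((u ⬝ᵥ z + η / 3) / a x) * Real.exp (-(1 / 2 * (z ⬝ᵥ u) + η) / a x) := by
    rw [← Real.exp_add, hL]; congr 1; ring
  rw [hexp] at hkey
  exact le_of_mul_le_mul_left hkey (Real.exp_pos _)

end HasQuadraticCumulantLimit

/-! ### From exponential estimates to the large deviation principle. -/

section Speed

variable {Ω : Type*} [MeasurableSpace Ω] {μ : Measure Ω} [IsProbabilityMeasure μ]

lemma mul_log_measure_le {a c : ℝ} (ha : 0 < a) {S : Set Ω}
    (h : μ.real S ≤ Real.exp (c / a)) :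
    ((1 / (1 / a) : ℝ) : EReal) * ENNReal.log (μ S) ≤ c := by
  have h1 : μ S ≤ ENNReal.ofReal (Real.exp (c / a)) :=
    (ENNReal.le_ofReal_iff_toReal_le (measure_ne_top _ _) (Real.exp_pos _).le).2 h
  have h2 := ENNReal.log_le_log h1
  rw [ENNReal.log_ofReal_of_pos (Real.exp_pos _), Real.log_exp] at h2
  rw [one_div_one_div]
  calc (a : EReal) * ENNReal.log (μ S) ≤ a * ((c / a : ℝ) : EReal) :=
        mul_le_mul_of_nonneg_left h2 (EReal.coe_nonneg.2 ha.le)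
    _ = c := by rw [← EReal.coe_mul, mul_div_cancel₀ _ ha.ne']

lemma le_mul_log_measure {a c : ℝ} (ha : 0 < a) {S : Set Ω}
    (h : Real.exp (c / a) ≤ μ.real S) :
    (c : EReal) ≤ ((1 / (1 / a) : ℝ) : EReal) * ENNReal.log (μ S) := by
  have h1 : ENNReal.ofReal (Real.exp (c / a)) ≤ μ S :=
    (ENNReal.ofReal_le_iff_le_toReal (measure_ne_top _ _)).2 h
  have h2 := ENNReal.log_le_log h1
  rw [ENNReal.log_ofReal_of_pos (Real.exp_pos _), Real.log_exp] at h2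
  rw [one_div_one_div]
  calc (c : EReal) = a * ((c / a : ℝ) : EReal) := by
        rw [← EReal.coe_mul, mul_div_cancel₀ _ ha.ne']
    _ ≤ a * ENNReal.log (μ S) := mul_le_mul_of_nonneg_left h2 (EReal.coe_nonneg.2 ha.le)

end Speed

/-- The Gärtner–Ellis theorem for a positive definite quadratic limit. -/
theorem HasQuadraticCumulantLimit.satisfiesLDP {Ω : Type*} [MeasurableSpace Ω] {μ : Measure Ω}
    [IsProbabilityMeasure μ] {a : ℝ → ℝ} {Z : ℝ → Ω → Fin 2 → ℝ} {C : Matrix (Fin 2) (Fin 2) ℝ}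
    (h : HasQuadraticCumulantLimit μ atTop a Z C) (hC : C.PosDef) :
    SatisfiesLDP μ Z (fun x => 1 / a x) (quadraticRate C) where
  speed_tendsto := by
    simpa only [one_div, Function.comp_def] using
      tendsto_inv_nhdsGT_zero.comp (tendsto_nhdsWithin_iff.2 ⟨h.tendsto_zero, h.pos⟩)
  isRateFunction := (isGoodRateFunction_quadraticRate hC).toIsRateFunction
  upper_bound F _ := by
    by_contra! hlt
    obtain ⟨c, hc1, hc2⟩ := EReal.lt_iff_exists_real_btwn.1 hlt
    refine hc2.not_ge (limsup_le_of_le (h := ?_))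
    have hev : ∀ᶠ x in atTop, μ.real {ω | Z x ω ∈ F} ≤ Real.exp (c / a x) := by
      -- For c ≥ 0 the bound of a probability by 1 suffices; only c < 0 needs the half-space
      -- estimate.
      rcases le_or_gt 0 c with hc | hc
      · filter_upwards [h.pos] with x hx
        exact measureReal_le_one.trans (Real.one_le_exp (by positivity))
      · have hJ : ((-c : ℝ) : EReal) < ⨅ z ∈ F, quadraticRate C z := by
          rw [EReal.coe_neg]; exact EReal.neg_lt_comm.1 hc1
        obtain ⟨r, hr1, hr2⟩ := EReal.lt_iff_exists_real_btwn.1 hJ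
        have hr1' : -c < r := EReal.coe_lt_coe_iff.1 hr1
        have hF : ∀ z ∈ F, r ≤ 1 / 2 * (z ⬝ᵥ (C⁻¹ *ᵥ z)) := fun z hz =>
          EReal.coe_le_coe_iff.1 (hr2.le.trans (iInf₂_le z hz))
        simpa using h.eventually_measureReal_le hC (r' := (-c + r) / 2) (s := -c) (by linarith)
          (by linarith) hF (by linarith)
    filter_upwards [h.pos, hev] with x hx hle using mul_log_measure_le hx hle
  lower_bound O hO := by
    by_contra! hlt
    obtain ⟨c, hc1, hc2⟩ := EReal.lt_iff_exists_real_btwn.1 hlt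
    refine hc1.not_ge (le_liminf_of_le (h := ?_))
    have hJ : ⨅ z ∈ O, quadraticRate C z < ((-c : ℝ) : EReal) := by
      rw [EReal.coe_neg]; exact EReal.lt_neg_comm.1 hc2
    simp only [iInf_lt_iff] at hJ
    obtain ⟨z, hz, hzc⟩ := hJ
    have hzc' : 1 / 2 * (z ⬝ᵥ (C⁻¹ *ᵥ z)) < -c := EReal.coe_lt_coe_iff.1 hzc
    filter_upwards [h.pos, h.eventually_le_measureReal hC (hO.mem_nhds hz)
      (show 0 < -c - 1 / 2 * (z ⬝ᵥ (C⁻¹ *ᵥ z)) by linarith)] with x hx hle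
    refine le_mul_log_measure hx ?_
    convert hle using 3
    ring

/-- The path identities hold only where all holding times are positive, an event of full measure;
this transfers the principle from the explicit sums. -/
lemma SatisfiesLDP.congr_ae {Ω E : Type*} [MeasurableSpace Ω] [TopologicalSpace E] {μ : Measure Ω}
    {Z Z' : ℝ → Ω → E} {v : ℝ → ℝ} {I : E → EReal} (h : SatisfiesLDP μ Z v I)
    (hZ : ∀ᶠ x in atTop, Z' x =ᵐ[μ] Z x) : SatisfiesLDP μ Z' v I := by
  have hS : ∀ S : Set E, (fun x : ℝ => ((1 / v x : ℝ) : EReal) * ENNReal.log (μ {ω | Z' x ω ∈ S}))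
      =ᶠ[atTop] fun x : ℝ => ((1 / v x : ℝ) : EReal) * ENNReal.log (μ {ω | Z x ω ∈ S}) := by
    intro S
    filter_upwards [hZ] with x hx
    congr 2
    exact measure_congr (hx.mono fun ω hω => congrArg (· ∈ S) hω)
  exact ⟨h.speed_tendsto, h.isRateFunction,
    fun F hF => (limsup_congr (hS F)).trans_le (h.upper_bound F hF),
    fun O hO => (h.lower_bound O hO).trans_eq (liminf_congr (hS O)).symm⟩

/-! ### Passage time and area as weighted sums of holding times. -/

section Path

variable {Ω : Type*} {T : ℕ → Ω → ℝ} {ω : Ω}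

lemma coe_ennreal_natCast_eq_coe_real (n : ℕ) : ((n : ℝ≥0∞) : EReal) = ((n : ℝ) : EReal) := by
  rw [← ENNReal.ofReal_natCast, EReal.coe_ennreal_ofReal, max_eq_left n.cast_nonneg]

lemma arrivalTime_succ (T : ℕ → Ω → ℝ) (n : ℕ) (ω : Ω) :
    arrivalTime T (n + 1) ω = arrivalTime T n ω + T n ω :=
  Finset.sum_range_succ _ _

lemma strictMono_arrivalTime (hT : ∀ k, 0 < T k ω) : StrictMono fun n => arrivalTime T n ω :=
  strictMono_nat_of_lt_succ fun n => by
    rw [arrivalTime_succ]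
    exact lt_add_of_pos_right _ (hT n)

lemma le_renewalProcess (hT : ∀ k, 0 < T k ω) {n : ℕ} {t : ℝ} (h : arrivalTime T n ω ≤ t) :
    (n : ℝ≥0∞) ≤ renewalProcess T t ω := by
  calc (n : ℝ≥0∞) = ∑ k ∈ Finset.range n, if arrivalTime T (k + 1) ω ≤ t then 1 else 0 := by
        rw [Finset.sum_congr rfl fun k hk => if_pos
          (((strictMono_arrivalTime hT).monotone (Finset.mem_range.1 hk)).trans h)]
        simp
    _ ≤ _ := ENNReal.sum_le_tsum _

lemma renewalProcess_le (hT : ∀ k, 0 < T k ω) {n : ℕ} {t : ℝ} (h : t < arrivalTime T (n + 1) ω) :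
    renewalProcess T t ω ≤ n := by
  rw [renewalProcess, tsum_eq_sum (s := Finset.range n) fun k hk => if_neg (not_le.2 (h.trans_le
    ((strictMono_arrivalTime hT).monotone (Nat.succ_le_succ (not_lt.1 (Finset.mem_range.not.1 hk))))))]
  calc _ ≤ ∑ _k ∈ Finset.range n, (1 : ℝ≥0∞) :=
        Finset.sum_le_sum fun k _ => by split_ifs <;> simp
    _ = n := by simp

/-- N counts arrivals, so reaching the real level x means reaching ⌈x⌉. -/
lemma levelProcess_nonpos_iff (hT : ∀ k, 0 < T k ω) {x t : ℝ} (hx : 0 < x) :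
    levelProcess T x t ω ≤ 0 ↔ arrivalTime T ⌈x⌉₊ ω ≤ t := by
  rw [levelProcess, EReal.sub_nonpos]
  constructor
  · intro h
    by_contra! hlt
    obtain ⟨n, hn⟩ := Nat.exists_eq_succ_of_ne_zero (Nat.ceil_pos.2 hx).ne'
    rw [hn] at hlt
    have h1 : (renewalProcess T t ω : EReal) ≤ ((n : ℝ≥0∞) : EReal) :=
      EReal.coe_ennreal_le_coe_ennreal_iff.2 (renewalProcess_le hT hlt)
    have h2 : (x : EReal) ≤ ((n : ℝ) : EReal) := by
      rw [← coe_ennreal_natCast_eq_coe_real]; exact h.trans h1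
    have h3 : ⌈x⌉₊ ≤ n := Nat.ceil_le.2 (EReal.coe_le_coe_iff.1 h2)
    omega
  · intro h
    calc (x : EReal) ≤ ((⌈x⌉₊ : ℝ) : EReal) := EReal.coe_le_coe_iff.2 (Nat.le_ceil x)
      _ = ((⌈x⌉₊ : ℝ≥0∞) : EReal) := (coe_ennreal_natCast_eq_coe_real _).symm
      _ ≤ _ := EReal.coe_ennreal_le_coe_ennreal_iff.2 (le_renewalProcess hT h)

lemma levelProcess_of_mem_Ico (hT : ∀ k, 0 < T k ω) (x : ℝ) {k : ℕ} {t : ℝ}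
    (ht : t ∈ Set.Ico (arrivalTime T k ω) (arrivalTime T (k + 1) ω)) :
    levelProcess T x t ω = ((x - k : ℝ) : EReal) := by
  rw [levelProcess, le_antisymm (renewalProcess_le hT ht.2) (le_renewalProcess hT ht.1),
    coe_ennreal_natCast_eq_coe_real, EReal.coe_sub]

lemma passageTime_eq (hT : ∀ k, 0 < T k ω) {x : ℝ} (hx : 0 < x) :
    passageTime T x ω = ∑ k ∈ Finset.range ⌈x⌉₊, T k ω := by
  have h : {t : ℝ | 0 ≤ t ∧ levelProcess T x t ω ≤ 0} = Set.Ici (arrivalTime T ⌈x⌉₊ ω) := by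
    ext t
    rw [Set.mem_ofPred_eq, levelProcess_nonpos_iff hT hx, Set.mem_Ici, and_iff_right_iff_imp]
    exact fun ht => le_trans (Finset.sum_nonneg fun k _ => (hT k).le) ht
  rw [passageTime, h, csInf_Ici, arrivalTime]

lemma passageArea_eq (hT : ∀ k, 0 < T k ω) {x : ℝ} (hx : 0 < x) :
    passageArea T x ω = ∑ k ∈ Finset.range ⌈x⌉₊, (x - k) * T k ω := by
  have hle : ∀ k, arrivalTime T k ω ≤ arrivalTime T (k + 1) ω := fun k =>
    (strictMono_arrivalTime hT).monotone k.le_succ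
  -- The area splits into rectangles of height x - k and width `T k`; values at the arrival times do
  -- not affect the integral.
  have heq : ∀ k : ℕ, Set.EqOn (fun _ => x - (k : ℝ)) (fun t => (levelProcess T x t ω).toReal)
      (Set.Ioo (arrivalTime T k ω) (arrivalTime T (k + 1) ω)) := fun k t ht => by
    simp only [levelProcess_of_mem_Ico hT x (Set.Ioo_subset_Ico_self ht), EReal.toReal_coe]
  have h0 : arrivalTime T 0 ω = 0 := Finset.sum_range_zero _
  have hn : passageTime T x ω = arrivalTime T ⌈x⌉₊ ω := passageTime_eq hT hx
  rw [passageArea, hn, ← h0,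
    ← intervalIntegral.sum_integral_adjacent_intervals (a := fun k => arrivalTime T k ω)
      fun k _ => intervalIntegrable_const.congr_uIoo (by rw [Set.uIoo_of_le (hle k)]; exact heq k)]
  refine Finset.sum_congr rfl fun k _ => ?_
  rw [← intervalIntegral.integral_congr_Ioo_of_le (hle k) (heq k), intervalIntegral.integral_const,
    arrivalTime_succ, add_sub_cancel_left, smul_eq_mul, mul_comm]

end Path

/-! ### Taylor expansion and Riemann sums of the weights. -/

section Asymptotics

/-- The second-order Taylor expansion with Peano remainder. -/
lemma eventually_abs_sub_taylor_two_le {f : ℝ → ℝ} (hf : ∀ᶠ y in 𝓝 0, DifferentiableAt ℝ f y)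
    (hf' : DifferentiableAt ℝ (deriv f) 0) {δ : ℝ} (hδ : 0 < δ) :
    ∀ᶠ y in 𝓝 (0 : ℝ),
      |f y - (f 0 + deriv f 0 * y + deriv (deriv f) 0 / 2 * y ^ 2)| ≤ δ * y ^ 2 := by
  set m := deriv f 0
  set s := deriv (deriv f) 0
  -- Differentiability of f' at 0 bounds the derivative of the remainder by δ |w|; the mean value
  -- inequality on the ball of radius |y| turns this into δ y².
  have hlo := (hasDerivAt_iff_isLittleO.1 hf'.hasDerivAt).def hδ
  obtain ⟨ρ, hρ, h⟩ := Metric.eventually_nhds_iff_ball.1 (hf.and hlo)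
  refine Metric.eventually_nhds_iff_ball.2 ⟨ρ, hρ, fun y hy => ?_⟩
  set g : ℝ → ℝ := fun y => f y - (f 0 + m * y + s / 2 * y ^ 2)
  have hsub : ∀ w ∈ Metric.closedBall (0 : ℝ) |y|, w ∈ Metric.ball (0 : ℝ) ρ := fun w hw => by
    simp only [Metric.mem_closedBall, Metric.mem_ball, Real.dist_eq, sub_zero] at *
    linarith
  have hder : ∀ w ∈ Metric.closedBall (0 : ℝ) |y|,
      HasDerivWithinAt g (deriv f w - (m + s * w)) (Metric.closedBall (0 : ℝ) |y|) w := fun w hw => by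
    have h1 := (h w (hsub w hw)).1.hasDerivAt
    have h2 : HasDerivAt (fun y : ℝ => f 0 + m * y + s / 2 * y ^ 2) (m + s * w) w := by
      exact ((((hasDerivAt_id w).const_mul m).const_add (f 0)).add
        (((hasDerivAt_id w).pow 2).const_mul (s / 2))).congr_deriv (by
          simp only [id, Nat.cast_ofNat, mul_one]; ring)
    exact (h1.sub h2).hasDerivWithinAt
  have hbound : ∀ w ∈ Metric.closedBall (0 : ℝ) |y|, ‖deriv f w - (m + s * w)‖ ≤ δ * |y| :=
    fun w hw => by
      have h1 := (h w (hsub w hw)).2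
      simp only [sub_zero, smul_eq_mul, Real.norm_eq_abs] at h1 ⊢
      have hw' : |w| ≤ |y| := by simpa [Real.dist_eq] using hw
      calc |deriv f w - (m + s * w)| = |deriv f w - deriv f 0 - w * s| := by
            congr 1; simp only [m]; ring
        _ ≤ δ * |w| := h1
        _ ≤ δ * |y| := by gcongr
  have hmv := (convex_closedBall (0 : ℝ) |y|).norm_image_sub_le_of_norm_hasDerivWithin_le hder hbound
    (Metric.mem_closedBall_self (abs_nonneg y)) (y := y) (by simp)
  have hg0 : g 0 = 0 := by simp [g]
  rw [hg0, sub_zero, sub_zero, Real.norm_eq_abs, Real.norm_eq_abs, mul_assoc, abs_mul_abs_self,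
    ← sq] at hmv
  exact hmv

lemma sum_range_id_cast (n : ℕ) : ∑ k ∈ Finset.range n, (k : ℝ) = n * (n - 1) / 2 := by
  induction n with
  | zero => simp
  | succ n ih => rw [Finset.sum_range_succ, ih]; push_cast; ring

lemma sum_range_sq_cast (n : ℕ) :
    ∑ k ∈ Finset.range n, (k : ℝ) ^ 2 = n * (n - 1) * (2 * n - 1) / 6 := by
  induction n with
  | zero => simp
  | succ n ih => rw [Finset.sum_range_succ, ih]; push_cast; ring

/-- The weight of the `k`-th holding time in `u₀ τ(x) + u₁ A(x) / x`. -/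
noncomputable def holdingWeight (u : Fin 2 → ℝ) (x : ℝ) (k : ℕ) : ℝ := u 0 + u 1 * (1 - k / x)

lemma abs_holdingWeight_le (u : Fin 2 → ℝ) {x : ℝ} (hx : 0 < x) {k : ℕ}
    (hk : k ∈ Finset.range ⌈x⌉₊) : |holdingWeight u x k| ≤ |u 0| + |u 1| := by
  have hkx : (k : ℝ) / x ≤ 1 := (div_le_one hx).2 (Nat.lt_ceil.1 (Finset.mem_range.1 hk)).le
  have hk0 : 0 ≤ (k : ℝ) / x := by positivity
  calc |holdingWeight u x k| ≤ |u 0| + |u 1 * (1 - k / x)| := abs_add_le _ _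
    _ = |u 0| + |u 1| * |1 - k / x| := by rw [abs_mul]
    _ ≤ |u 0| + |u 1| * 1 := by
        gcongr
        exact abs_le.2 ⟨by linarith, by linarith⟩
    _ = _ := by rw [mul_one]

/-- Writing ⌈x⌉ = x + d with 0 ≤ d ≤ 1, the terms linear in x cancel and only bounded rounding terms
remain. -/
lemma abs_sum_holdingWeight_sub_le (u : Fin 2 → ℝ) {x : ℝ} (hx : 1 ≤ x) :
    |∑ k ∈ Finset.range ⌈x⌉₊, holdingWeight u x k - x * (u 0 + u 1 / 2)|
      ≤ |u 0 + u 1| + |u 1| := by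
  have hx0 : 0 < x := by linarith
  set n : ℝ := ((⌈x⌉₊ : ℕ) : ℝ)
  obtain ⟨d, hd⟩ : ∃ d, n = x + d := ⟨n - x, by ring⟩
  have hd0 : 0 ≤ d := by have : x ≤ n := Nat.le_ceil x; linarith
  have hd1 : d ≤ 1 := by have : n < x + 1 := Nat.ceil_lt_add_one hx0.le; linarith
  have hsum : ∑ k ∈ Finset.range ⌈x⌉₊, holdingWeight u x k - x * (u 0 + u 1 / 2)
      = (u 0 + u 1) * d + u 1 * (-((2 * d - 1 + d * (d - 1) / x) / 2)) := by
    calc _ = n * (u 0 + u 1) - u 1 / x * (∑ k ∈ Finset.range ⌈x⌉₊, (k : ℝ))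
          - x * (u 0 + u 1 / 2) := by
          have hc : n * (u 0 + u 1) = ∑ _k ∈ Finset.range ⌈x⌉₊, (u 0 + u 1) := by
            rw [Finset.sum_const, Finset.card_range, nsmul_eq_mul]
          rw [hc, Finset.mul_sum, ← Finset.sum_sub_distrib]
          congr 1
          exact Finset.sum_congr rfl fun k _ => by rw [holdingWeight]; ring
      _ = _ := by
          rw [sum_range_id_cast]
          change n * (u 0 + u 1) - u 1 / x * (n * (n - 1) / 2) - x * (u 0 + u 1 / 2) = _
          rw [hd]
          field_simp
          ring
  have hdd : |d * (d - 1) / x| ≤ 1 := by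
    rw [abs_div, abs_of_pos hx0, div_le_one hx0, abs_mul, abs_of_nonneg hd0]
    have : |d - 1| ≤ 1 := abs_le.2 ⟨by linarith, by linarith⟩
    nlinarith [abs_nonneg (d - 1)]
  have hdd' := abs_le.1 hdd
  rw [hsum]
  calc _ ≤ |(u 0 + u 1) * d| + |u 1 * (-((2 * d - 1 + d * (d - 1) / x) / 2))| := abs_add_le _ _
    _ ≤ |u 0 + u 1| * 1 + |u 1| * 1 := by
        rw [abs_mul, abs_mul]
        gcongr
        · exact abs_le.2 ⟨by linarith, hd1⟩
        · exact abs_le.2 ⟨by linarith, by linarith⟩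
    _ = _ := by ring

/-- A Riemann sum of ∫₀¹ (u₀ + u₁(1 - s))² ds, evaluated through closed forms. -/
lemma tendsto_inv_mul_sum_holdingWeight_sq (u : Fin 2 → ℝ) :
    Tendsto (fun x : ℝ => x⁻¹ * ∑ k ∈ Finset.range ⌈x⌉₊, holdingWeight u x k ^ 2) atTop
      (𝓝 (u 0 ^ 2 + u 0 * u 1 + u 1 ^ 2 / 3)) := by
  have hy := tendsto_nat_ceil_div_atTop (R := ℝ)
  have hi : Tendsto (fun x : ℝ => x⁻¹) atTop (𝓝 0) := tendsto_inv_atTop_zero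
  have h := ((hy.const_mul ((u 0 + u 1) ^ 2)).sub
    ((hy.mul (hy.sub hi)).const_mul ((u 0 + u 1) * u 1))).add
    (((hy.mul (hy.sub hi)).mul ((hy.const_mul 2).sub hi)).const_mul (u 1 ^ 2 / 6))
  have hlim : u 0 ^ 2 + u 0 * u 1 + u 1 ^ 2 / 3 = (u 0 + u 1) ^ 2 * 1
      - (u 0 + u 1) * u 1 * (1 * (1 - 0)) + u 1 ^ 2 / 6 * (1 * (1 - 0) * (2 * 1 - 0)) := by ring
  rw [hlim]
  refine h.congr' ?_
  filter_upwards [eventually_gt_atTop 0] with x hx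
  have hsum : ∑ k ∈ Finset.range ⌈x⌉₊, holdingWeight u x k ^ 2
      = ⌈x⌉₊ * (u 0 + u 1) ^ 2 - 2 * (u 0 + u 1) * u 1 / x * (∑ k ∈ Finset.range ⌈x⌉₊, (k : ℝ))
        + u 1 ^ 2 / x ^ 2 * (∑ k ∈ Finset.range ⌈x⌉₊, (k : ℝ) ^ 2) := by
    have hc : (⌈x⌉₊ : ℝ) * (u 0 + u 1) ^ 2 = ∑ _k ∈ Finset.range ⌈x⌉₊, (u 0 + u 1) ^ 2 := by simp
    rw [hc, Finset.mul_sum, Finset.mul_sum, ← Finset.sum_sub_distrib, ← Finset.sum_add_distrib]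
    exact Finset.sum_congr rfl fun k _ => by rw [holdingWeight]; field_simp; ring
  rw [hsum, sum_range_id_cast, sum_range_sq_cast]
  field_simp

lemma tendsto_mul_sum_holdingWeight {f a : ℝ → ℝ} (hf0 : f 0 = 0)
    (hf : ∀ᶠ y in 𝓝 0, DifferentiableAt ℝ f y) (hf' : DifferentiableAt ℝ (deriv f) 0)
    (ha_pos : ∀ x, 0 < x → 0 < a x) (ha_zero : Tendsto a atTop (𝓝 0))
    (ha_top : Tendsto (fun x => x * a x) atTop atTop) (u : Fin 2 → ℝ) :
    Tendsto (fun x => a x * (∑ k ∈ Finset.range ⌈x⌉₊, f ((√(x * a x))⁻¹ * holdingWeight u x k)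
        - (√(x * a x))⁻¹ * (x * (u 0 + u 1 / 2)) * deriv f 0)) atTop
      (𝓝 (deriv (deriv f) 0 / 2 * (u 0 ^ 2 + u 0 * u 1 + u 1 ^ 2 / 3))) := by
  set m := deriv f 0
  set s := deriv (deriv f) 0
  set ε : ℝ → ℝ := fun x => (√(x * a x))⁻¹
  set W := |u 0| + |u 1|
  set R : ℝ → ℝ := fun y => f y - (f 0 + m * y + s / 2 * y ^ 2)
  have hε : Tendsto ε atTop (𝓝 0) :=
    tendsto_inv_atTop_zero.comp (Real.tendsto_sqrt_atTop.comp ha_top)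
  have hεsq : ∀ x, 0 < x → a x * ε x ^ 2 = x⁻¹ := fun x hx => by
    have hax := ha_pos x hx
    simp only [ε]
    rw [inv_pow, Real.sq_sqrt (by positivity)]
    field_simp
  have hmean : Tendsto (fun x => m * (a x * ε x) *
      (∑ k ∈ Finset.range ⌈x⌉₊, holdingWeight u x k - x * (u 0 + u 1 / 2))) atTop (𝓝 0) := by
    have h0 : Tendsto (fun x => m * (a x * ε x)) atTop (𝓝 0) := by
      simpa using (ha_zero.mul hε).const_mul m
    refine h0.zero_mul_isBoundedUnder_le ⟨|u 0 + u 1| + |u 1|, ?_⟩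
    rw [eventually_map]
    filter_upwards [eventually_ge_atTop 1] with x hx using abs_sum_holdingWeight_sub_le u hx
  have hrem : Tendsto (fun x => a x * ∑ k ∈ Finset.range ⌈x⌉₊, R (ε x * holdingWeight u x k))
      atTop (𝓝 0) := by
    rw [Metric.tendsto_nhds]
    intro η hη
    -- There are at most 2x terms, each at most δ ε² W², and a ε² = 1/x, so the remainder is at most
    -- 2 δ W² < η; the + 1 covers W = 0.
    set δ := η / (4 * (W ^ 2 + 1))
    have hδ : 0 < δ := by positivity
    obtain ⟨ρ, hρ, hR⟩ := Metric.eventually_nhds_iff_ball.1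
      (eventually_abs_sub_taylor_two_le hf hf' hδ)
    have hεW : Tendsto (fun x => ε x * W) atTop (𝓝 0) := by simpa using hε.mul_const W
    filter_upwards [eventually_gt_atTop 0, hεW.eventually_lt_const hρ,
      (tendsto_nat_ceil_div_atTop (R := ℝ)).eventually_lt_const one_lt_two] with x hx hsmall hn
    have hax := ha_pos x hx
    have hεx : 0 ≤ ε x := inv_nonneg.2 (Real.sqrt_nonneg _)
    have hk : ∀ k ∈ Finset.range ⌈x⌉₊, |R (ε x * holdingWeight u x k)| ≤ δ * (ε x ^ 2 * W ^ 2) := by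
      intro k hk
      have hw := abs_holdingWeight_le u hx hk
      have habs : |ε x * holdingWeight u x k| ≤ ε x * W := by
        rw [abs_mul, abs_of_nonneg hεx]; gcongr
      refine (hR _ (by rw [Metric.mem_ball, Real.dist_eq, sub_zero]; linarith)).trans ?_
      rw [← mul_pow, ← sq_abs (ε x * holdingWeight u x k)]
      gcongr
    rw [Real.dist_eq, sub_zero, abs_mul, abs_of_pos hax]
    calc a x * |∑ k ∈ Finset.range ⌈x⌉₊, R (ε x * holdingWeight u x k)|
        ≤ a x * ∑ k ∈ Finset.range ⌈x⌉₊, δ * (ε x ^ 2 * W ^ 2) := by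
          gcongr
          exact (Finset.abs_sum_le_sum_abs _ _).trans (Finset.sum_le_sum hk)
      _ = (a x * ε x ^ 2) * ⌈x⌉₊ * (δ * W ^ 2) := by
          rw [Finset.sum_const, Finset.card_range, nsmul_eq_mul]; ring
      _ = ⌈x⌉₊ / x * (δ * W ^ 2) := by rw [hεsq x hx]; ring
      _ ≤ 2 * (δ * W ^ 2) := by gcongr
      _ < η := by
          have : δ * (4 * (W ^ 2 + 1)) = η := div_mul_cancel₀ _ (by positivity)
          nlinarith [sq_nonneg W]
  have h := (hmean.add ((tendsto_inv_mul_sum_holdingWeight_sq u).const_mul (s / 2))).add hrem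
  rw [zero_add, add_zero] at h
  refine h.congr' ?_
  filter_upwards [eventually_gt_atTop 0] with x hx
  have hf_eq : ∀ k, f (ε x * holdingWeight u x k) = m * ε x * holdingWeight u x k
      + s / 2 * ε x ^ 2 * holdingWeight u x k ^ 2 + R (ε x * holdingWeight u x k) := fun k => by
    simp only [R, hf0]; ring
  rw [Finset.sum_congr rfl fun k _ => hf_eq k, Finset.sum_add_distrib, Finset.sum_add_distrib,
    ← Finset.mul_sum, ← Finset.mul_sum, ← hεsq x hx]
  ring

end Asymptotics

lemma covMatrix_dotProduct_mulVec (s : ℝ) (u : Fin 2 → ℝ) :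
    u ⬝ᵥ (covMatrix s *ᵥ u) = s * (u 0 ^ 2 + u 0 * u 1 + u 1 ^ 2 / 3) := by
  simp [covMatrix, dotProduct, Matrix.mulVec, Fin.sum_univ_two]
  ring

lemma posDef_covMatrix {s : ℝ} (hs : 0 < s) : (covMatrix s).PosDef := by
  refine Matrix.PosDef.of_dotProduct_mulVec_pos ?_ fun u hu => ?_
  · ext i j
    fin_cases i <;> fin_cases j <;> simp [covMatrix]
  · rw [star_trivial, covMatrix_dotProduct_mulVec]
    refine mul_pos hs ?_
    have hsq : u 0 ^ 2 + u 0 * u 1 + u 1 ^ 2 / 3 = (u 0 + u 1 / 2) ^ 2 + u 1 ^ 2 / 12 := by ring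
    rw [hsq]
    by_cases h1 : u 1 = 0
    · have h0 : u 0 ≠ 0 := fun h0 => hu (by ext i; fin_cases i <;> simp [h0, h1])
      rw [h1]
      simp only [zero_div, add_zero]
      positivity
    · positivity

/-! ### Cumulants of the scaled pair. -/

section Cumulants

variable {Ω : Type*} [MeasurableSpace Ω] {μ : Measure Ω} [IsProbabilityMeasure μ]

/-- The second derivative at 0 is the variance, which vanishes only for an almost surely constant
variable. -/
lemma deriv_deriv_cgf_zero_pos {X : Ω → ℝ} (h : 0 ∈ interior (integrableExpSet X μ))
    (hX : ¬ ∃ c : ℝ, ∀ᵐ ω ∂μ, X ω = c) : 0 < deriv (deriv (cgf X μ)) 0 := by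
  set m := deriv (cgf X μ) 0 with hm
  have heq : deriv (deriv (cgf X μ)) 0 = ∫ ω, (X ω - m) ^ 2 ∂μ := by
    have h2 := iteratedDeriv_two_cgf_eq_integral h
    rw [iteratedDeriv_succ, iteratedDeriv_one] at h2
    simpa using h2
  have hint : Integrable (fun ω => (X ω - m) ^ 2) μ :=
    ((memLp_of_mem_interior_integrableExpSet h 2).sub (memLp_const m)).integrable_sq
  rw [heq]
  refine lt_of_le_of_ne (integral_nonneg fun ω => sq_nonneg _) fun h0 => hX ⟨m, ?_⟩
  filter_upwards [(integral_eq_zero_iff_of_nonneg (fun ω => sq_nonneg _) hint).1 h0.symm] with ω hω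
  exact sub_eq_zero.1 (pow_eq_zero_iff two_ne_zero |>.1 hω)

/-- The explicit expression of `scaledPair` in terms of the holding times. -/
noncomputable def weightedPair (T : ℕ → Ω → ℝ) (a : ℝ → ℝ) (m x : ℝ) (ω : Ω) : Fin 2 → ℝ :=
  √(x * a x) • ![(∑ k ∈ Finset.range ⌈x⌉₊, T k ω) / x - m,
    (∑ k ∈ Finset.range ⌈x⌉₊, (x - k) * T k ω) / x ^ 2 - 1 / 2 * m]

variable {T : ℕ → Ω → ℝ} {a : ℝ → ℝ}

omit [IsProbabilityMeasure μ] in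
lemma scaledPair_ae_eq_weightedPair (hT_pos : ∀ n, ∀ᵐ ω ∂μ, 0 < T n ω) (m : ℝ) {x : ℝ}
    (hx : 0 < x) : scaledPair T a m x =ᵐ[μ] weightedPair T a m x := by
  filter_upwards [ae_all_iff.2 hT_pos] with ω hω
  rw [scaledPair, weightedPair, passageTime_eq hω hx, passageArea_eq hω hx]

omit [MeasurableSpace Ω] in
lemma inv_mul_dotProduct_weightedPair (T : ℕ → Ω → ℝ) {x : ℝ} (hx : 0 < x) (ha : 0 < a x) (m : ℝ)
    (u : Fin 2 → ℝ) (ω : Ω) :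
    (a x)⁻¹ * (u ⬝ᵥ weightedPair T a m x ω) =
      ∑ k ∈ Finset.range ⌈x⌉₊, (√(x * a x))⁻¹ * holdingWeight u x k * T k ω
        - (√(x * a x))⁻¹ * (x * (u 0 + u 1 / 2)) * m := by
  have hq : 0 < √(x * a x) := Real.sqrt_pos.2 (by positivity)
  have hqq : √(x * a x) ^ 2 = x * a x := Real.sq_sqrt (by positivity)
  -- This identity turns the speed and the normalisation into the single small parameter 1/√(x a_x).
  have hscale : (a x)⁻¹ * √(x * a x) = (√(x * a x))⁻¹ * x := by
    rw [inv_mul_eq_div, inv_mul_eq_div, div_eq_div_iff ha.ne' hq.ne', ← sq, hqq]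
  have hsum : ∑ k ∈ Finset.range ⌈x⌉₊, (√(x * a x))⁻¹ * holdingWeight u x k * T k ω =
      (√(x * a x))⁻¹ * x * (u 0 * ((∑ k ∈ Finset.range ⌈x⌉₊, T k ω) / x)
        + u 1 * ((∑ k ∈ Finset.range ⌈x⌉₊, (x - k) * T k ω) / x ^ 2)) := by
    rw [Finset.sum_div, Finset.sum_div, Finset.mul_sum, Finset.mul_sum, ← Finset.sum_add_distrib,
      Finset.mul_sum]
    refine Finset.sum_congr rfl fun k _ => ?_
    rw [holdingWeight]
    field_simp
  rw [hsum, weightedPair, dotProduct_smul, smul_eq_mul, ← mul_assoc, hscale]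
  simp only [dotProduct, Fin.sum_univ_two, Matrix.cons_val_zero, Matrix.cons_val_one]
  ring

lemma measurable_weightedPair (hT_meas : ∀ n, Measurable (T n)) (m x : ℝ) :
    Measurable (weightedPair T a m x) := by
  refine measurable_pi_iff.2 fun i => ?_
  fin_cases i
  · exact (((Finset.measurable_sum _ fun k _ => hT_meas k).div_const x).sub_const m).const_mul _
  · exact (((Finset.measurable_sum _ fun k _ => (hT_meas k).const_mul (x - k)).div_const
      (x ^ 2)).sub_const (1 / 2 * m)).const_mul _

lemma integrable_exp_and_cgf_weightedPair (hT_meas : ∀ n, Measurable (T n))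
    (hT_indep : iIndepFun T μ) (hT_ident : ∀ n, IdentDistrib (T n) (T 0) μ μ)
    {x : ℝ} (hx : 0 < x) (ha : 0 < a x) (m : ℝ) {u : Fin 2 → ℝ}
    (hu : ∀ k ∈ Finset.range ⌈x⌉₊,
      (√(x * a x))⁻¹ * holdingWeight u x k ∈ integrableExpSet (T 0) μ) :
    Integrable (fun ω => Real.exp ((a x)⁻¹ * (u ⬝ᵥ weightedPair T a m x ω))) μ ∧
      cgf (fun ω => u ⬝ᵥ weightedPair T a m x ω) μ (a x)⁻¹ =
        ∑ k ∈ Finset.range ⌈x⌉₊, cgf (T 0) μ ((√(x * a x))⁻¹ * holdingWeight u x k)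
          - (√(x * a x))⁻¹ * (x * (u 0 + u 1 / 2)) * m := by
  set c := (√(x * a x))⁻¹ * (x * (u 0 + u 1 / 2)) * m
  set Y : ℕ → Ω → ℝ := fun k ω => (√(x * a x))⁻¹ * holdingWeight u x k * T k ω
  have hYm : ∀ k, Measurable (Y k) := fun k => (hT_meas k).const_mul _
  have hYi : iIndepFun Y μ := hT_indep.comp
    (fun k y => (√(x * a x))⁻¹ * holdingWeight u x k * y) fun k => measurable_const_mul _
  have hYint : ∀ k ∈ Finset.range ⌈x⌉₊, Integrable (fun ω => Real.exp (1 * Y k ω)) μ := by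
    intro k hk
    have hid : IdentDistrib (fun ω => Real.exp ((√(x * a x))⁻¹ * holdingWeight u x k * T k ω))
        (fun ω => Real.exp ((√(x * a x))⁻¹ * holdingWeight u x k * T 0 ω)) μ μ :=
      (hT_ident k).comp (measurable_const_mul _).exp
    simpa only [one_mul] using hid.integrable_iff.2 (hu k hk)
  have hexp : ∀ ω, Real.exp ((a x)⁻¹ * (u ⬝ᵥ weightedPair T a m x ω)) =
      Real.exp (1 * (∑ k ∈ Finset.range ⌈x⌉₊, Y k) ω) * Real.exp (-c) := fun ω => by
    rw [inv_mul_dotProduct_weightedPair T hx ha, ← Real.exp_add, one_mul, Finset.sum_apply,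
      sub_eq_add_neg]
  have hSint := hYi.integrable_exp_mul_sum hYm hYint
  refine ⟨by simpa only [hexp] using hSint.mul_const _, ?_⟩
  have hcgf : cgf (fun ω => u ⬝ᵥ weightedPair T a m x ω) μ (a x)⁻¹ =
      cgf (∑ k ∈ Finset.range ⌈x⌉₊, Y k) μ 1 - c := by
    rw [cgf, mgf]
    simp only [hexp]
    rw [integral_mul_const, Real.log_mul (integral_exp_pos hSint).ne' (Real.exp_pos _).ne',
      Real.log_exp, ← sub_eq_add_neg]
    rfl
  rw [hcgf, hYi.cgf_sum hYm hYint]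
  congr 1
  refine Finset.sum_congr rfl fun k _ => ?_
  rw [cgf, cgf, mgf_const_mul, mul_one, mgf_congr_identDistrib (hT_ident k)]

lemma hasQuadraticCumulantLimit_weightedPair (hT_meas : ∀ n, Measurable (T n))
    (hT_indep : iIndepFun T μ) (hT_ident : ∀ n, IdentDistrib (T n) (T 0) μ μ)
    (hT_light : (0 : ℝ) ∈ interior (integrableExpSet (T 0) μ))
    (ha_pos : ∀ x, 0 < x → 0 < a x) (ha_zero : Tendsto a atTop (𝓝 0))
    (ha_top : Tendsto (fun x => x * a x) atTop atTop) :
    HasQuadraticCumulantLimit μ atTop a (weightedPair T a (deriv (cgf (T 0) μ) 0))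
      (covMatrix (deriv (deriv (cgf (T 0) μ)) 0)) := by
  -- The weights are bounded uniformly in k and the scale vanishes, so eventually all arguments lie
  -- in a ball around 0 where the mgf is finite.
  have hev : ∀ u : Fin 2 → ℝ, ∀ᶠ x in atTop, ∀ k ∈ Finset.range ⌈x⌉₊,
      (√(x * a x))⁻¹ * holdingWeight u x k ∈ integrableExpSet (T 0) μ := by
    intro u
    obtain ⟨ρ, hρ, hball⟩ := Metric.mem_nhds_iff.1 (mem_interior_iff_mem_nhds.1 hT_light)
    have hεW : Tendsto (fun x => (√(x * a x))⁻¹ * (|u 0| + |u 1|)) atTop (𝓝 0) := by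
      simpa using (tendsto_inv_atTop_zero.comp (Real.tendsto_sqrt_atTop.comp ha_top)).mul_const
        (|u 0| + |u 1|)
    filter_upwards [eventually_gt_atTop 0, hεW.eventually_lt_const hρ] with x hx hsmall k hk
    refine hball ?_
    rw [Metric.mem_ball, Real.dist_eq, sub_zero, abs_mul,
      abs_of_nonneg (inv_nonneg.2 (Real.sqrt_nonneg _))]
    exact (mul_le_mul_of_nonneg_left (abs_holdingWeight_le u hx hk)
      (inv_nonneg.2 (Real.sqrt_nonneg _))).trans_lt hsmall
  have han := analyticAt_cgf hT_light
  refine ⟨measurable_weightedPair hT_meas _, ?_, ha_zero, fun u => ?_, fun u => ?_⟩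
  · filter_upwards [eventually_gt_atTop 0] with x hx using ha_pos x hx
  · filter_upwards [eventually_gt_atTop 0, hev u] with x hx hu
    exact (integrable_exp_and_cgf_weightedPair hT_meas hT_indep hT_ident hx (ha_pos x hx) _ hu).1
  · have hlim := tendsto_mul_sum_holdingWeight cgf_zero
      (han.eventually_analyticAt.mono fun y hy => hy.differentiableAt) han.deriv.differentiableAt
      ha_pos ha_zero ha_top u
    rw [covMatrix_dotProduct_mulVec, ← mul_assoc, one_div_mul_eq_div]
    refine hlim.congr' ?_
    filter_upwards [eventually_gt_atTop 0, hev u] with x hx hu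
    rw [(integrable_exp_and_cgf_weightedPair hT_meas hT_indep hT_ident hx (ha_pos x hx) _ hu).2]

end Cumulants

end RenewalArea

theorem proposition2 {Ω : Type*} [MeasurableSpace Ω] (μ : Measure Ω) [IsProbabilityMeasure μ]
    (T : ℕ → Ω → ℝ)
    (hT_meas : ∀ n, Measurable (T n))
    (hT_pos : ∀ n, ∀ᵐ ω ∂μ, 0 < T n ω)
    (hT_indep : iIndepFun T μ)
    (hT_ident : ∀ n, IdentDistrib (T n) (T 0) μ μ)
    (hT_light : (0 : ℝ) ∈ interior (integrableExpSet (T 0) μ))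
    (hT_nondeg : ¬ ∃ c : ℝ, ∀ᵐ ω ∂μ, T 0 ω = c)
    (a : ℝ → ℝ) (ha_pos : ∀ x, 0 < x → 0 < a x)
    (ha_zero : Tendsto a atTop (𝓝 0))
    (ha_top : Tendsto (fun x => x * a x) atTop atTop) :
    RenewalArea.SatisfiesLDP μ
        (RenewalArea.scaledPair T a (deriv (cgf (T 0) μ) 0))
        (fun x => 1 / a x)
        (RenewalArea.quadraticRate
          (RenewalArea.covMatrix (deriv (deriv (cgf (T 0) μ)) 0))) ∧
      RenewalArea.IsGoodRateFunction
        (RenewalArea.quadraticRate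
          (RenewalArea.covMatrix (deriv (deriv (cgf (T 0) μ)) 0))) := by
  have hC := RenewalArea.posDef_covMatrix
    (RenewalArea.deriv_deriv_cgf_zero_pos hT_light hT_nondeg)
  refine ⟨?_, RenewalArea.isGoodRateFunction_quadraticRate hC⟩
  refine ((RenewalArea.hasQuadraticCumulantLimit_weightedPair hT_meas hT_indep hT_ident hT_light
    ha_pos ha_zero ha_top).satisfiesLDP hC).congr_ae ?_
  filter_upwards [eventually_gt_atTop 0] with x hx
  exact RenewalArea.scaledPair_ae_eq_weightedPair hT_pos _ hx
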